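/- Let $q=p^e$ be a power of a prime $p>3$, let $A=\mathbb{F}_q[T]$, and let $K$ be an algebraically closed field containing $A$ (for instance $\mathbb{C}_\infty$). A Drinfeld $A$-module of rank $3$ over $K$ is an $\mathbb{F}_q$-linear ring homomorphism $a\mapsto\phi_a$ from $A$ to the ring of $q$-polynomials $\sum_i c_ix^{q^i}$ over $K$ (with composition as multiplication) with $\phi_T=Tx+g_1x^q+g_2x^{q^2}+g_3x^{q^3}$, $g_3\neq 0$. For $\mathfrak{a}=(T^2+T+1)$, a self $\mathfrak{a}$-cyclic isogeny of $\phi$ is a nonzero $q$-polynomial $f$ with $f\phi_b=\phi_bf$ for all $b\in A$ whose kernel (an $A$-module through $\phi$) is isomorphic to $A/\mathfrak{a}$. An invariant $J$ is a nonzero element of the $A$-algebra generated by the basic $J$-invariants $g_1^{\delta_1}g_2^{\delta_2}/g_3^{\delta_3}$, where $\delta_i\ge 0$ are integers with $\delta_1(q-1)+\delta_2(q^2-1)=\delta_3(q^3-1)$, $\delta_i\le (q^3-1)/(q-1)$ for $i=1,2$, and $\gcd(\delta_1,\delta_2,\delta_3)=1$. Set $$\mathcal{N}_q=(q^3+1)(q^2-1)\left(30q^{15}-4q^{14}+q^{12}+2q^{11}-q^{10}-2q^9-q^8\right).$$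 Then: 1. The number of rank-$3$ Drinfeld $A$-modules $\phi$ over $K$ that have a monic self $\mathfrak{a}$-cyclic isogeny is finite and at most $\mathcal{N}_q$. 2. The number of isomorphism classes of rank-$3$ Drinfeld $A$-modules over $K$ that have a self $\mathfrak{a}$-cyclic isogeny is finite and at most $\mathcal{N}_q$. 3. The pairs $(\phi,f)$, with $f$ a monic self $\mathfrak{a}$-cyclic isogeny of a rank-$3$ Drinfeld $A$-module $\phi$ over $K$, form finitely many classes up to isomorphic copy, and for every invariant $J$ the polynomial $\Phi_{J,T^2+T+1}(X,X)=\prod_{(\phi,f)}(X-J(\phi))$, the product being over these classes, satisfies $$\deg_X\Phi_{J,T^2+T+1}(X,X)\le\mathcal{N}_q.$$ This holds both when the isomorphic copies of $(\phi,f)$ are the pairs $(c^{-1}\phi c,\;c^{-1}fd)$ with $c,d\in K^*$ and $c^{-1}\phi c=d^{-1}\phi d$, and when they are only the pairs $(c^{-1}\phi c,\;c^{-1}fc)$ with $c\in K^*$. -/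

import Mathlib

open Polynomial

/-! Throughout, `A = Fq[X]` is the polynomial ring over the finite field `Fq` (its variable `X` is
the `T` of the theory), `q = Fintype.card Fq`, and `K` is an `A`-field, that is, a field with a
ring homomorphism `algebraMap A K`. -/

namespace Drinfeld

/-- The `q`-power Frobenius is additive in rings that receive a homomorphism from `Fq`. -/
theorem add_pow_card_pow (Fq : Type*) [Field Fq] [Fintype Fq] {R : Type*} [CommRing R]
    [Nontrivial R] (j : Fq →+* R) (x y : R) (i : ℕ) :
    (x + y) ^ Fintype.card Fq ^ i = x ^ Fintype.card Fq ^ i + y ^ Fintype.card Fq ^ i := by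
  obtain ⟨p, hp⟩ := CharP.exists Fq
  obtain ⟨n, hpp, hn⟩ := FiniteField.card Fq p
  have := Fact.mk hpp
  have : CharP R p := charP_of_injective_ringHom j.injective p
  rw [hn, ← pow_mul]
  exact add_pow_char_pow x y p (n * i)

/-- The inclusion of `Fq` into `K[X]`. -/
noncomputable def constHom (Fq K : Type*) [Field Fq] [Field K] [Algebra Fq[X] K] :
    Fq →+* K[X] :=
  (C : K →+* K[X]).comp ((algebraMap Fq[X] K).comp (C : Fq →+* Fq[X]))

/-- The `q`-polynomials `∑ cᵢ x ^ (q ^ i)` with coefficients in `K`, as a subspace of `K[x]`. -/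
noncomputable def qSpan (Fq K : Type*) [Fintype Fq] [Field K] : Submodule K K[X] :=
  Submodule.span K (Set.range fun i : ℕ => (X : K[X]) ^ Fintype.card Fq ^ i)

theorem C_mul_X_mem_qSpan {Fq K : Type*} [Fintype Fq] [Field K] (c : K) : C c * X ∈ qSpan Fq K := by
  rw [← smul_eq_C_mul]
  exact Submodule.smul_mem _ _ (Submodule.subset_span ⟨0, by simp⟩)

theorem X_mem_qSpan {Fq K : Type*} [Fintype Fq] [Field K] : (X : K[X]) ∈ qSpan Fq K := by
  simpa using C_mul_X_mem_qSpan (Fq := Fq) (1 : K)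

section closure

variable {Fq K : Type*} [Field Fq] [Fintype Fq] [Field K] [Algebra Fq[X] K]

theorem pow_mem_qSpan {g : K[X]} (hg : g ∈ qSpan Fq K) (i : ℕ) :
    g ^ Fintype.card Fq ^ i ∈ qSpan Fq K := by
  induction hg using Submodule.span_induction with
  | mem x hx =>
    obtain ⟨j, rfl⟩ := hx
    refine Submodule.subset_span ⟨j + i, ?_⟩
    simp only [← pow_mul, ← pow_add]
  | zero =>
    rw [zero_pow (pow_ne_zero _ Fintype.card_ne_zero)]
    exact Submodule.zero_mem _
  | add x y _ _ hx hy =>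
    rw [add_pow_card_pow Fq (constHom Fq K)]
    exact Submodule.add_mem _ hx hy
  | smul a x _ hx =>
    rw [_root_.smul_pow]
    exact Submodule.smul_mem _ _ hx

theorem comp_mem_qSpan {f g : K[X]} (hf : f ∈ qSpan Fq K) (hg : g ∈ qSpan Fq K) :
    f.comp g ∈ qSpan Fq K := by
  induction hf using Submodule.span_induction with
  | mem x hx =>
    obtain ⟨j, rfl⟩ := hx
    simpa using pow_mem_qSpan hg j
  | zero => simp
  | add x y _ _ hx hy => simpa using Submodule.add_mem _ hx hy
  | smul a x _ hx => simpa using Submodule.smul_mem _ a hx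

theorem comp_add_qSpan {f : K[X]} (hf : f ∈ qSpan Fq K) (g h : K[X]) :
    f.comp (g + h) = f.comp g + f.comp h := by
  induction hf using Submodule.span_induction with
  | mem x hx =>
    obtain ⟨j, rfl⟩ := hx
    simpa using add_pow_card_pow Fq (constHom Fq K) g h j
  | zero => simp
  | add x y _ _ hx hy => simp only [add_comp, hx, hy]; ring
  | smul a x _ hx => simp only [smul_comp, hx, smul_add]

end closure

/-- The ring `K<x>` of `q`-polynomials, with the usual addition and with composition as
multiplication. -/
@[ext] structure QPoly (Fq K : Type*) [Fintype Fq] [Field K] where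
  poly : K[X]
  poly_mem : poly ∈ qSpan Fq K

namespace QPoly

variable {Fq K : Type*} [Field Fq] [Fintype Fq] [Field K] [Algebra Fq[X] K]

noncomputable instance : Ring (QPoly Fq K) where
  add f g := ⟨f.poly + g.poly, Submodule.add_mem _ f.poly_mem g.poly_mem⟩
  zero := ⟨0, Submodule.zero_mem _⟩
  neg f := ⟨-f.poly, Submodule.neg_mem _ f.poly_mem⟩
  mul f g := ⟨f.poly.comp g.poly, comp_mem_qSpan f.poly_mem g.poly_mem⟩
  one := ⟨X, X_mem_qSpan⟩
  nsmul n f := ⟨n • f.poly, nsmul_mem f.poly_mem n⟩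
  nsmul_zero f := QPoly.ext (zero_nsmul f.poly)
  nsmul_succ n f := QPoly.ext (succ_nsmul f.poly n)
  zsmul n f := ⟨n • f.poly, zsmul_mem f.poly_mem n⟩
  zsmul_zero' f := QPoly.ext (zero_zsmul f.poly)
  zsmul_succ' n f := QPoly.ext (SubNegMonoid.zsmul_succ' n f.poly)
  zsmul_neg' n f := QPoly.ext (SubNegMonoid.zsmul_neg' n f.poly)
  add_assoc f g h := QPoly.ext (add_assoc f.poly g.poly h.poly)
  zero_add f := QPoly.ext (zero_add f.poly)
  add_zero f := QPoly.ext (add_zero f.poly)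
  add_comm f g := QPoly.ext (add_comm f.poly g.poly)
  neg_add_cancel f := QPoly.ext (neg_add_cancel f.poly)
  left_distrib f g h := QPoly.ext (comp_add_qSpan f.poly_mem g.poly h.poly)
  right_distrib f g h := QPoly.ext (add_comp (p := f.poly) (q := g.poly) (r := h.poly))
  zero_mul f := QPoly.ext (zero_comp (p := f.poly))
  mul_zero f := QPoly.ext (by
    have h := comp_add_qSpan f.poly_mem 0 0
    rw [add_zero] at h
    exact left_eq_add.mp h)
  mul_assoc f g h := QPoly.ext (comp_assoc f.poly g.poly h.poly)
  one_mul f := QPoly.ext (X_comp (p := f.poly))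
  mul_one f := QPoly.ext (comp_X (p := f.poly))

@[simp] theorem poly_mul (f g : QPoly Fq K) : (f * g).poly = f.poly.comp g.poly := rfl

@[simp] theorem poly_add (f g : QPoly Fq K) : (f + g).poly = f.poly + g.poly := rfl

@[simp] theorem poly_one : (1 : QPoly Fq K).poly = X := rfl

@[simp] theorem poly_zero : (0 : QPoly Fq K).poly = 0 := rfl

theorem eval_add (f : QPoly Fq K) (x y : K) :
    f.poly.eval (x + y) = f.poly.eval x + f.poly.eval y := by
  have h := congrArg (eval 0) (comp_add_qSpan f.poly_mem (C x) (C y))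
  rw [← C_add] at h
  simpa using h

theorem eval_zero (f : QPoly Fq K) : f.poly.eval 0 = 0 := by
  have h := eval_add f 0 0
  rw [add_zero] at h
  exact left_eq_add.mp h

/-- The scalar `c`, as the `q`-polynomial `c x`. -/
noncomputable def scal (c : K) : QPoly Fq K := ⟨C c * X, C_mul_X_mem_qSpan c⟩

theorem poly_scal {Fq K : Type*} [Fintype Fq] [Field K] (c : K) : (scal c : QPoly Fq K).poly = C c * X := rfl

/-- The invertible `q`-polynomials are the nonzero scalars. -/
theorem exists_unit_eq (u : (QPoly Fq K)ˣ) : ∃ c : K, c ≠ 0 ∧ (u : QPoly Fq K) = scal c := by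
  have h1 : (u : QPoly Fq K).poly.comp ((u⁻¹ : (QPoly Fq K)ˣ) : QPoly Fq K).poly = X := by
    rw [← poly_mul, Units.mul_inv, poly_one]
  have h2 := congrArg natDegree h1
  rw [natDegree_comp, natDegree_X] at h2
  have h3 : (u : QPoly Fq K).poly.natDegree ≤ 1 := (Nat.eq_one_of_mul_eq_one_right h2).le
  obtain ⟨a, b, hab⟩ := exists_eq_X_add_C_of_natDegree_le_one h3
  have hb : b = 0 := by
    have := eval_zero (u : QPoly Fq K)
    rw [hab] at this
    simpa using this
  subst hb
  refine ⟨a, ?_, QPoly.ext (by rw [hab, poly_scal]; simp)⟩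
  rintro rfl
  rw [hab] at h1
  simp at h1
  exact X_ne_zero h1.symm

end QPoly

/-- A Drinfeld `Fq[X]`-module of rank `r` over the `A`-field `K`: a ring homomorphism
`a ↦ φ_a` from `A` to `K<x>` that is the natural one on constants, with
`φ_T = T x + g₁ x ^ q + ⋯ + g_r x ^ (q ^ r)` and `g_r ≠ 0`. -/
structure DrinfeldModule (Fq K : Type*) [Field Fq] [Fintype Fq] [Field K] [Algebra Fq[X] K]
    (r : ℕ) where
  toRingHom : Fq[X] →+* QPoly Fq K
  map_const : ∀ c : Fq, toRingHom (C c) = QPoly.scal (algebraMap Fq[X] K (C c))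
  coeff_one : (toRingHom X).poly.coeff 1 = algebraMap Fq[X] K X
  natDegree_eq : (toRingHom X).poly.natDegree = Fintype.card Fq ^ r

namespace DrinfeldModule

section basics

variable {Fq K : Type*} [Field Fq] [Fintype Fq] [Field K] [Algebra Fq[X] K] {r : ℕ}

/-- The coefficient `g i` of `x ^ (q ^ i)` in `φ_T`. -/
noncomputable def g (φ : DrinfeldModule Fq K r) (i : ℕ) : K :=
  (φ.toRingHom X).poly.coeff (Fintype.card Fq ^ i)

/-- The action `b • α = φ_b(α)` of `A` on `K`. -/
noncomputable def act (φ : DrinfeldModule Fq K r) (b : Fq[X]) (α : K) : K :=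
  (φ.toRingHom b).poly.eval α

theorem act_mul (φ : DrinfeldModule Fq K r) (a b : Fq[X]) (α : K) :
    φ.act (a * b) α = φ.act a (φ.act b α) := by
  simp [act, eval_comp]

theorem act_add (φ : DrinfeldModule Fq K r) (a b : Fq[X]) (α : K) :
    φ.act (a + b) α = φ.act a α + φ.act b α := by
  simp [act]

theorem act_one (φ : DrinfeldModule Fq K r) (α : K) : φ.act 1 α = α := by simp [act]

theorem act_zero (φ : DrinfeldModule Fq K r) (α : K) : φ.act 0 α = 0 := by simp [act]

/-- The field `K` with the `A`-action `b • α = φ_b(α)`. -/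
def Points (_φ : DrinfeldModule Fq K r) : Type _ := K

noncomputable instance (φ : DrinfeldModule Fq K r) : AddCommGroup φ.Points :=
  inferInstanceAs (AddCommGroup K)

noncomputable instance (φ : DrinfeldModule Fq K r) : Module Fq[X] φ.Points where
  smul := φ.act
  one_smul := φ.act_one
  mul_smul := φ.act_mul
  smul_zero a := QPoly.eval_zero (φ.toRingHom a)
  smul_add a := QPoly.eval_add (φ.toRingHom a)
  add_smul := φ.act_add
  zero_smul := φ.act_zero

/-- `u` is a morphism `φ → ψ`: `u φ_a = ψ_a u` for all `a`. -/
def IsHom (φ ψ : DrinfeldModule Fq K r) (u : QPoly Fq K) : Prop :=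
  ∀ a : Fq[X], u * φ.toRingHom a = ψ.toRingHom a * u

theorem IsHom.eval_act {φ ψ : DrinfeldModule Fq K r} {u : QPoly Fq K} (hu : IsHom φ ψ u)
    (a : Fq[X]) (α : K) : u.poly.eval (φ.act a α) = ψ.act a (u.poly.eval α) := by
  rw [act, act, ← eval_comp, ← eval_comp, ← QPoly.poly_mul, hu a, QPoly.poly_mul]

/-- The kernel of a morphism, as an `A`-submodule of `K` with the action through `φ`. -/
def ker {φ ψ : DrinfeldModule Fq K r} {u : QPoly Fq K} (hu : IsHom φ ψ u) :
    Submodule Fq[X] φ.Points where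
  carrier := {α : K | u.poly.eval α = 0}
  add_mem' hx hy := (QPoly.eval_add u _ _).trans ((congrArg₂ (· + ·) hx hy).trans (add_zero 0))
  zero_mem' := QPoly.eval_zero u
  smul_mem' a x hx :=
    (hu.eval_act a x).trans ((congrArg (ψ.act a) hx).trans (QPoly.eval_zero _))

/-- `u : φ → ψ` is an `(n)`-cyclic isogeny (for `K` algebraically closed): a nonzero morphism
whose kernel is isomorphic to `A / (n)` as an `A`-module. -/
def IsCyclicIsogeny (n : Fq[X]) (φ ψ : DrinfeldModule Fq K r) (u : QPoly Fq K) : Prop :=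
  u ≠ 0 ∧ ∃ hu : IsHom φ ψ u, Nonempty (ker hu ≃ₗ[Fq[X]] (Fq[X] ⧸ Ideal.span {n}))

/-- Isomorphism of Drinfeld modules: a morphism that is invertible in `K<x>`. -/
def isoSetoid (Fq K : Type*) [Field Fq] [Fintype Fq] [Field K] [Algebra Fq[X] K] (r : ℕ) :
    Setoid (DrinfeldModule Fq K r) where
  r φ ψ := ∃ u : (QPoly Fq K)ˣ, IsHom φ ψ u
  iseqv :=
    { refl := fun φ => ⟨1, fun a => by simp⟩
      symm := by
        rintro φ ψ ⟨u, hu⟩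
        refine ⟨u⁻¹, fun a => ?_⟩
        rw [Units.inv_mul_eq_iff_eq_mul, ← mul_assoc, hu a, Units.mul_inv_cancel_right]
      trans := by
        rintro φ ψ χ ⟨u, hu⟩ ⟨v, hv⟩
        refine ⟨v * u, fun a => ?_⟩
        rw [Units.val_mul, mul_assoc, hu a, ← mul_assoc, hv a, mul_assoc] }

end basics

section invariants

variable {Fq K : Type*} [Field Fq] [Fintype Fq] [Field K] [Algebra Fq[X] K] {r : ℕ}

/-- The admissible exponents `(δ₁, …, δ_r)` of the basic `J`-invariants. -/
structure IsBasicExponent (q r : ℕ) (δ : ℕ → ℕ) : Prop where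
  weight : ∑ i ∈ Finset.Icc 1 (r - 1), δ i * (q ^ i - 1) = δ r * (q ^ r - 1)
  bound : ∀ i ∈ Finset.Icc 1 (r - 1), δ i ≤ (q ^ r - 1) / (q ^ Nat.gcd i r - 1)
  gcd_eq_one : (Finset.Icc 1 r).gcd δ = 1

/-- The basic `J`-invariant `g₁ ^ δ₁ ⋯ g_{r-1} ^ δ_{r-1} / g_r ^ δ_r`. -/
noncomputable def basicJ (δ : ℕ → ℕ) (φ : DrinfeldModule Fq K r) : K :=
  (∏ i ∈ Finset.Icc 1 (r - 1), φ.g i ^ δ i) / φ.g r ^ δ r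

theorem g_of_iso {φ ψ : DrinfeldModule Fq K r} (h : isoSetoid Fq K r φ ψ) :
    ∃ c : K, c ≠ 0 ∧ ∀ i, φ.g i = c ^ (Fintype.card Fq ^ i - 1) * ψ.g i := by
  obtain ⟨u, hu⟩ := h
  obtain ⟨c, hc, huc⟩ := QPoly.exists_unit_eq u
  refine ⟨c, hc, fun i => ?_⟩
  have h1 := congrArg (fun f : QPoly Fq K => f.poly.coeff (Fintype.card Fq ^ i)) (hu X)
  simp only [huc, QPoly.poly_mul, QPoly.poly_scal, mul_comp, C_comp, X_comp, coeff_C_mul,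
    comp_C_mul_X_coeff] at h1
  have hq : Fintype.card Fq ^ i = (Fintype.card Fq ^ i - 1) + 1 :=
    (Nat.sub_add_cancel (Nat.one_le_pow _ _ Fintype.card_pos)).symm
  have h2 : c ^ Fintype.card Fq ^ i = c ^ (Fintype.card Fq ^ i - 1) * c := by
    conv_lhs => rw [hq, pow_succ]
  rw [h2] at h1
  apply mul_left_cancel₀ hc
  calc c * φ.g i = _ := h1
    _ = c * (c ^ (Fintype.card Fq ^ i - 1) * ψ.g i) := by rw [g]; ring

theorem basicJ_of_iso {δ : ℕ → ℕ} (hδ : IsBasicExponent (Fintype.card Fq) r δ)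
    {φ ψ : DrinfeldModule Fq K r} (h : isoSetoid Fq K r φ ψ) : basicJ δ φ = basicJ δ ψ := by
  obtain ⟨c, hc, hg⟩ := g_of_iso h
  unfold basicJ
  simp only [hg, mul_pow, Finset.prod_mul_distrib, ← pow_mul, Finset.prod_pow_eq_pow_sum]
  have hw := hδ.weight
  simp only [mul_comm (δ _)] at hw
  rw [hw]
  exact mul_div_mul_left _ _ (pow_ne_zero _ hc)

/-- The invariants of rank `r` Drinfeld modules over `K`: the nonzero elements of the `A`-algebra
generated by the basic `J`-invariants. -/
structure Invariant (Fq K : Type*) [Field Fq] [Fintype Fq] [Field K] [Algebra Fq[X] K]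
    (r : ℕ) where
  toFun : DrinfeldModule Fq K r → K
  mem_adjoin : toFun ∈ Algebra.adjoin Fq[X]
    {f : DrinfeldModule Fq K r → K |
      ∃ δ : ℕ → ℕ, IsBasicExponent (Fintype.card Fq) r δ ∧ f = basicJ δ}
  ne_zero : toFun ≠ 0

theorem Invariant.of_iso (J : Invariant Fq K r) {φ ψ : DrinfeldModule Fq K r}
    (h : isoSetoid Fq K r φ ψ) : J.toFun φ = J.toFun ψ := by
  refine Algebra.adjoin_induction (p := fun f _ => f φ = f ψ) ?_ ?_ ?_ ?_ J.mem_adjoin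
  · rintro _ ⟨δ, hδ, rfl⟩
    exact basicJ_of_iso hδ h
  · intro a
    simp [Pi.algebraMap_apply]
  · intro f g _ _ hf hg
    simp [hf, hg]
  · intro f g _ _ hf hg
    simp [hf, hg]

end invariants

section modularPolynomial

variable {Fq K : Type*} [Field Fq] [Fintype Fq] [Field K] [Algebra Fq[X] K]

/-- A rank `r` Drinfeld module over `K` together with a monic `(n)`-cyclic self-isogeny. -/
structure SelfPair (K : Type*) {Fq : Type*} [Field Fq] [Fintype Fq] [Field K] [Algebra Fq[X] K]
    (r : ℕ) (n : Fq[X]) where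
  mod : DrinfeldModule Fq K r
  isog : QPoly Fq K
  cyclic : IsCyclicIsogeny n mod mod isog
  monic : isog.poly.Monic

/-- `(ψ, g)` is an isomorphic copy `(c⁻¹ φ c, c⁻¹ f c)` of `(φ, f)`. -/
def conjSetoid (K : Type*) {Fq : Type*} [Field Fq] [Fintype Fq] [Field K] [Algebra Fq[X] K]
    (r : ℕ) (n : Fq[X]) : Setoid (SelfPair K r n) where
  r x y := ∃ u : (QPoly Fq K)ˣ, IsHom x.mod y.mod u ∧ (u : QPoly Fq K) * x.isog = y.isog * u
  iseqv :=
    { refl := fun x => ⟨1, fun a => by simp, by simp⟩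
      symm := by
        rintro x y ⟨u, hu, hf⟩
        refine ⟨u⁻¹, fun a => ?_, ?_⟩
        · rw [Units.inv_mul_eq_iff_eq_mul, ← mul_assoc, hu a, Units.mul_inv_cancel_right]
        · rw [Units.inv_mul_eq_iff_eq_mul, ← mul_assoc, hf, Units.mul_inv_cancel_right]
      trans := by
        rintro x y z ⟨u, hu, hf⟩ ⟨v, hv, hg⟩
        refine ⟨v * u, fun a => ?_, ?_⟩
        · rw [Units.val_mul, mul_assoc, hu a, ← mul_assoc, hv a, mul_assoc]
        · rw [Units.val_mul, mul_assoc, hf, ← mul_assoc, hg, mul_assoc] }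

/-- `(ψ, g)` is an isomorphic copy of `(φ, f)` in the wider sense: `g = c⁻¹ f d` where
`ψ = c⁻¹ φ c = d⁻¹ φ d`. Equivalently, the isogenies are identified up to automorphisms
of `φ` as well. -/
def copySetoid (K : Type*) {Fq : Type*} [Field Fq] [Fintype Fq] [Field K] [Algebra Fq[X] K]
    (r : ℕ) (n : Fq[X]) : Setoid (SelfPair K r n) where
  r x y := ∃ u v : (QPoly Fq K)ˣ, IsHom x.mod y.mod u ∧ IsHom x.mod y.mod v ∧
    (u : QPoly Fq K) * x.isog = y.isog * v
  iseqv :=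
    { refl := fun x => ⟨1, 1, fun a => by simp, fun a => by simp, by simp⟩
      symm := by
        rintro x y ⟨u, v, hu, hv, hf⟩
        refine ⟨u⁻¹, v⁻¹, fun a => ?_, fun a => ?_, ?_⟩
        · rw [Units.inv_mul_eq_iff_eq_mul, ← mul_assoc, hu a, Units.mul_inv_cancel_right]
        · rw [Units.inv_mul_eq_iff_eq_mul, ← mul_assoc, hv a, Units.mul_inv_cancel_right]
        · rw [Units.inv_mul_eq_iff_eq_mul, ← mul_assoc, hf, Units.mul_inv_cancel_right]
      trans := by
        rintro x y z ⟨u, v, hu, hv, hf⟩ ⟨u', v', hu', hv', hg⟩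
        refine ⟨u' * u, v' * v, fun a => ?_, fun a => ?_, ?_⟩
        · rw [Units.val_mul, mul_assoc, hu a, ← mul_assoc, hu' a, mul_assoc]
        · rw [Units.val_mul, mul_assoc, hv a, ← mul_assoc, hv' a, mul_assoc]
        · rw [Units.val_mul, Units.val_mul, mul_assoc, hf, ← mul_assoc, hg, mul_assoc] }

variable {r : ℕ}

/-- The invariant of a class of pairs `(φ, f)` up to isomorphic copies `c⁻¹ f d`. -/
def jCopy (J : Invariant Fq K r) (n : Fq[X]) : Quotient (copySetoid K r n) → K :=
  Quotient.lift (fun x => J.toFun x.mod) fun _ _ h =>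
    J.of_iso ⟨h.choose, h.choose_spec.choose_spec.1⟩

/-- The invariant of a class of pairs `(φ, f)` up to isomorphic copies `c⁻¹ f c`. -/
def jConj (J : Invariant Fq K r) (n : Fq[X]) : Quotient (conjSetoid K r n) → K :=
  Quotient.lift (fun x => J.toFun x.mod) fun _ _ h =>
    J.of_iso ⟨h.choose, h.choose_spec.1⟩

/-- The self-isogenous modular polynomial `Φ_{J,n}(X, X)`: the product of `X - J(φ)` over the
pairs `(φ, f)`, `f` a monic `(n)`-cyclic self-isogeny of `φ`, up to isomorphic copies
`c⁻¹ f d`. It is meaningful when there are finitely many classes. -/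
noncomputable def selfModularPoly (J : Invariant Fq K r) (n : Fq[X]) : K[X] :=
  ∏ᶠ x : Quotient (copySetoid K r n), (X - C (jCopy J n x))

/-- The variant of `Φ_{J,n}(X, X)` in which pairs are only identified up to simultaneous
conjugation `(c⁻¹ φ c, c⁻¹ f c)`; its roots occur with at least the same multiplicity. -/
noncomputable def selfModularPolyConj (J : Invariant Fq K r) (n : Fq[X]) : K[X] :=
  ∏ᶠ x : Quotient (conjSetoid K r n), (X - C (jConj J n x))

end modularPolynomial

end DrinfeldModule

/-- The bound `𝒩_q`. -/
def boundN (q : ℤ) : ℤ :=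
  (q ^ 3 + 1) * (q ^ 2 - 1) *
    (30 * q ^ 15 - 4 * q ^ 14 + q ^ 12 + 2 * q ^ 11 - q ^ 10 - 2 * q ^ 9 - q ^ 8)

end Drinfeld

/-!
Write `τ` for `x ^ q`, so that `q`-polynomials are twisted polynomials in `τ`. A monic self
`(T² + T + 1)`-cyclic isogeny `f` of `φ` is separable, because `T` is transcendental over `Fq`, and
its kernel has `q ^ 2` elements; hence `f = a + b τ + τ²` commutes with
`φ_T = T + g₁ τ + g₂ τ² + g₃ τ³`. All the quantities in question are bounded by the number of
commuting pairs `(φ, f)` of this shape (`monicEndPairs`): an isogeny can be made monic by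
conjugation over an algebraically closed field, and the classes of pairs are images of pairs. The
number of pairs turns out to be at most `8 q ^ 14`, which is less than `boundN q`.

* The values of `a` (`coeff_one_mem_linCoeffCandidates`). Comparing leading coefficients, the
  leading coefficients of the endomorphisms of given degree that commute with `f` lie on a line over
  `Fq`, so there are at most `q ^ 9` such endomorphisms of degree at most `q ^ 8`
  (`card_commute_le`). The ten monomials `f ^ i φ_T ^ j` with `2 i + 3 j ≤ 8` have `q ^ 10`
  combinations over `Fq`, so there is a nontrivial relation `∑ c_ij f ^ i φ_T ^ j = 0`. Its linear
  coefficient says that `a` is a root of the nonzero polynomial `∑ c_ij T ^ j Y ^ i`, of degree at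
  most `4`. This leaves at most `4 q ^ 10` values of `a`.
* The values of `g₃`. The top coefficient of `f φ_T = φ_T f` is `g₃ ^ (q ^ 2) = g₃`.
* The values of `g₁`. An endomorphism is determined by its linear coefficient
  (`eq_zero_of_linCoeff_eq_zero`), so `a` is not in a finite field (`linCoeff_pow_ne`). The
  coefficients of `τ` and `τ²` in `f φ_T = φ_T f` then express `b` and `g₂` through `a` and `g₁`, and
  the coefficient of `τ³` becomes an equation for `g₁` of degree at most `q ^ 2 + q + 1` with
  constant term `g₃ (a - a ^ (q ^ 3)) ≠ 0` (`gOnePoly`).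
-/

namespace Drinfeld

/-! ### Coefficients of `q`-polynomials -/

namespace QPoly

/-- A `q`-polynomial has no monomials other than the `x ^ (q ^ i)`. -/
theorem exists_eq_pow_of_coeff_ne_zero {Fq K : Type*} [Fintype Fq] [Field K] (u : QPoly Fq K)
    {n : ℕ} (hn : u.poly.coeff n ≠ 0) : ∃ i, n = Fintype.card Fq ^ i := by
  by_contra! h
  refine hn ?_
  have key : ∀ f ∈ qSpan Fq K, f.coeff n = 0 := by
    intro f hf
    induction hf using Submodule.span_induction with
    | mem x hx =>
      obtain ⟨j, rfl⟩ := hx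
      simp [coeff_X_pow, h j]
    | zero => simp
    | add x y _ _ hx hy => simp [hx, hy]
    | smul a x _ hx => simp [hx]
  exact key _ u.poly_mem

theorem ext_coeff {Fq K : Type*} [Fintype Fq] [Field K] {u v : QPoly Fq K}
    (h : ∀ i, u.poly.coeff (Fintype.card Fq ^ i) = v.poly.coeff (Fintype.card Fq ^ i)) :
    u = v := by
  refine QPoly.ext (Polynomial.ext fun n => ?_)
  by_cases hu : u.poly.coeff n = 0
  · by_cases hv : v.poly.coeff n = 0
    · rw [hu, hv]
    · obtain ⟨i, rfl⟩ := v.exists_eq_pow_of_coeff_ne_zero hv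
      exact h i
  · obtain ⟨i, rfl⟩ := u.exists_eq_pow_of_coeff_ne_zero hu
    exact h i

variable {Fq K : Type*} [Field Fq] [Fintype Fq] [Field K] [Algebra Fq[X] K]

theorem exists_natDegree_eq_pow {u : QPoly Fq K} (hu : u ≠ 0) :
    ∃ i, u.poly.natDegree = Fintype.card Fq ^ i := by
  refine u.exists_eq_pow_of_coeff_ne_zero ?_
  rw [coeff_natDegree, leadingCoeff_ne_zero]
  exact fun h => hu (QPoly.ext h)

theorem natDegree_lt_of_coeff_eq_zero {u : QPoly Fq K} {d : ℕ}
    (hd : u.poly.natDegree < Fintype.card Fq ^ (d + 1))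
    (hc : u.poly.coeff (Fintype.card Fq ^ d) = 0) :
    u.poly.natDegree < Fintype.card Fq ^ d := by
  by_cases hu : u = 0
  · rw [hu, poly_zero, natDegree_zero]
    exact pow_pos Fintype.card_pos _
  obtain ⟨i, hi⟩ := exists_natDegree_eq_pow hu
  have hq : 1 < Fintype.card Fq := Fintype.one_lt_card
  rw [hi] at hd ⊢
  refine Nat.pow_lt_pow_right hq (lt_of_le_of_ne
    (Nat.lt_succ_iff.1 ((Nat.pow_lt_pow_iff_right hq).1 hd)) ?_)
  rintro rfl
  rw [← hi, coeff_natDegree, leadingCoeff_eq_zero] at hc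
  exact hu (QPoly.ext hc)

theorem coeff_pow_card_pow {g : K[X]} (hg : g ∈ qSpan Fq K) (i n : ℕ) :
    (g ^ Fintype.card Fq ^ i).coeff (Fintype.card Fq ^ n) =
      if i ≤ n then g.coeff (Fintype.card Fq ^ (n - i)) ^ Fintype.card Fq ^ i else 0 := by
  have hq : 1 < Fintype.card Fq := Fintype.one_lt_card
  induction hg using Submodule.span_induction with
  | mem x hx =>
    obtain ⟨j, rfl⟩ := hx
    simp only [← pow_mul, ← pow_add, coeff_X_pow, Nat.pow_right_inj hq]
    split_ifs <;> first | omega | simp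
  | zero => simp
  | add x y _ _ hx hy =>
    rw [add_pow_card_pow Fq (constHom Fq K), coeff_add, coeff_add, hx, hy]
    split_ifs
    · rw [add_pow_card_pow Fq ((algebraMap Fq[X] K).comp (C : Fq →+* Fq[X]))]
    · simp
  | smul a x _ hx =>
    rw [_root_.smul_pow, coeff_smul, hx, coeff_smul]
    split_ifs <;> simp [mul_pow]

/-- Composition of `q`-polynomials is multiplication of twisted polynomials in `τ = x ^ q`. -/
theorem coeff_mul (u v : QPoly Fq K) (n : ℕ) :
    (u * v).poly.coeff (Fintype.card Fq ^ n) =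
      ∑ i ∈ Finset.range (n + 1), u.poly.coeff (Fintype.card Fq ^ i) *
        v.poly.coeff (Fintype.card Fq ^ (n - i)) ^ Fintype.card Fq ^ i := by
  have hq : 1 < Fintype.card Fq := Fintype.one_lt_card
  have key : ∀ f ∈ qSpan Fq K, (f.comp v.poly).coeff (Fintype.card Fq ^ n) =
      ∑ i ∈ Finset.range (n + 1), f.coeff (Fintype.card Fq ^ i) *
        v.poly.coeff (Fintype.card Fq ^ (n - i)) ^ Fintype.card Fq ^ i := by
    intro f hf
    induction hf using Submodule.span_induction with
    | mem x hx =>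
      obtain ⟨j, rfl⟩ := hx
      simp only [X_pow_comp, coeff_pow_card_pow v.poly_mem, coeff_X_pow, Nat.pow_right_inj hq,
        ite_mul, one_mul, zero_mul, Finset.sum_ite_eq', Finset.mem_range, Nat.lt_succ_iff]
    | zero => simp
    | add x y _ _ hx hy =>
      simp only [add_comp, coeff_add, hx, hy, add_mul, Finset.sum_add_distrib]
    | smul a x _ hx =>
      simp only [smul_comp, coeff_smul, hx, smul_eq_mul, Finset.mul_sum, mul_assoc]
  exact key _ u.poly_mem

/-- The derivative at `0`, that is, the linear coefficient, of a `q`-polynomial. -/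
noncomputable def linCoeff : QPoly Fq K →+* K where
  toFun u := u.poly.coeff 1
  map_one' := by simp
  map_mul' u v := by simpa using coeff_mul u v 0
  map_zero' := by simp
  map_add' u v := by simp

theorem linCoeff_apply (u : QPoly Fq K) : linCoeff u = u.poly.coeff 1 := rfl

theorem natDegree_poly_pow (u : QPoly Fq K) (n : ℕ) :
    (u ^ n).poly.natDegree = u.poly.natDegree ^ n := by
  induction n with
  | zero => simp
  | succ n ih => rw [pow_succ, poly_mul, natDegree_comp, ih, pow_succ]

theorem poly_sub (u v : QPoly Fq K) : (u - v).poly = u.poly - v.poly := by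
  rw [sub_eq_add_neg, sub_eq_add_neg]
  rfl

theorem poly_sum {ι : Type*} (s : Finset ι) (u : ι → QPoly Fq K) :
    (∑ i ∈ s, u i).poly = ∑ i ∈ s, (u i).poly :=
  map_sum (⟨⟨poly, poly_zero⟩, poly_add⟩ : QPoly Fq K →+ K[X]) u s

/-- The derivative of a `q`-polynomial is a constant, so a `q`-polynomial with nonzero linear
coefficient is separable. -/
theorem separable_of_linCoeff_ne_zero {u : QPoly Fq K} (hu : u.poly.coeff 1 ≠ 0) :
    u.poly.Separable := by
  have hcard : ((Fintype.card Fq : ℕ) : K) = 0 := by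
    have h := congrArg ((algebraMap Fq[X] K).comp (C : Fq →+* Fq[X]))
      (FiniteField.cast_card_eq_zero Fq)
    rwa [map_natCast, map_zero] at h
  have key : ∀ f ∈ qSpan Fq K, derivative f = C (f.coeff 1) := by
    intro f hf
    induction hf using Submodule.span_induction with
    | mem x hx =>
      obtain ⟨j, rfl⟩ := hx
      rcases j with _ | j
      · simp
      · have h1 : 1 ≠ Fintype.card Fq ^ (j + 1) :=
          (Nat.one_lt_pow j.succ_ne_zero Fintype.one_lt_card).ne
        simp [coeff_X_pow, h1, derivative_X_pow, hcard]
    | zero => simp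
    | add x y _ _ hx hy => simp [hx, hy]
    | smul a x _ hx => simp [hx, smul_eq_C_mul]
  rw [Separable, key _ u.poly_mem]
  exact ⟨0, C (u.poly.coeff 1)⁻¹, by rw [zero_mul, zero_add, ← C_mul, inv_mul_cancel₀ hu, C_1]⟩

end QPoly

namespace DrinfeldModule

/-! ### Endomorphisms in generic characteristic -/

section endomorphisms

variable {Fq K : Type*} [Field Fq] [Fintype Fq] [Field K] [Algebra Fq[X] K] {r : ℕ}

theorem algebraMap_X_pow_ne (hgen : Function.Injective (algebraMap Fq[X] K)) {m : ℕ}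
    (hm : m ≠ 0) : algebraMap Fq[X] K X ^ Fintype.card Fq ^ m ≠ algebraMap Fq[X] K X := by
  rw [← map_pow]
  intro h
  have h1 := congrArg natDegree (hgen h)
  rw [natDegree_X_pow, natDegree_X] at h1
  exact (Nat.one_lt_pow hm Fintype.one_lt_card).ne' h1

theorem linCoeff_comp_toRingHom (φ : DrinfeldModule Fq K r) :
    QPoly.linCoeff.comp φ.toRingHom = algebraMap Fq[X] K := by
  refine Polynomial.ringHom_ext' (RingHom.ext fun c => ?_) ?_
  · simp [φ.map_const, QPoly.linCoeff_apply, QPoly.poly_scal]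
  · exact φ.coeff_one

theorem ext_of_g {φ ψ : DrinfeldModule Fq K r}
    (h : ∀ i, φ.g i = ψ.g i) : φ = ψ := by
  have h1 : φ.toRingHom = ψ.toRingHom := by
    refine Polynomial.ringHom_ext' (RingHom.ext fun c => ?_) (QPoly.ext_coeff h)
    simp [φ.map_const, ψ.map_const]
  cases φ
  cases ψ
  subst h1
  rfl

theorem g_zero (φ : DrinfeldModule Fq K r) : φ.g 0 = algebraMap Fq[X] K X := by
  simpa [g] using φ.coeff_one

theorem g_rank_eq_leadingCoeff (φ : DrinfeldModule Fq K r) :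
    φ.g r = (φ.toRingHom X).poly.leadingCoeff := by
  rw [leadingCoeff, φ.natDegree_eq, g]

theorem g_rank_ne_zero (φ : DrinfeldModule Fq K r) : φ.g r ≠ 0 := by
  rw [g_rank_eq_leadingCoeff, leadingCoeff_ne_zero]
  intro h
  have h1 := φ.natDegree_eq
  rw [h, natDegree_zero] at h1
  exact pow_ne_zero _ Fintype.card_ne_zero h1.symm

theorem natDegree_toRingHom_monomial_le (φ : DrinfeldModule Fq K r) (j : ℕ) (c : Fq) :
    (φ.toRingHom (monomial j c)).poly.natDegree ≤ Fintype.card Fq ^ (r * j) := by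
  rw [← C_mul_X_pow_eq_monomial, map_mul, map_pow, φ.map_const, QPoly.poly_mul, natDegree_comp,
    QPoly.natDegree_poly_pow, φ.natDegree_eq, QPoly.poly_scal, pow_mul]
  exact (Nat.mul_le_mul_right _ (natDegree_C_mul_le _ _)).trans (by rw [natDegree_X, one_mul])

theorem g_eq_zero_of_lt (φ : DrinfeldModule Fq K r) {i : ℕ} (hi : r < i) : φ.g i = 0 := by
  refine coeff_eq_zero_of_natDegree_lt ?_
  rw [φ.natDegree_eq]
  exact Nat.pow_lt_pow_right Fintype.one_lt_card hi

/-- In generic characteristic an endomorphism is determined by its linear coefficient: comparing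
the lowest terms in `u φ_T = φ_T u` would give `T ^ (q ^ n) = T` with `n > 0`. -/
theorem eq_zero_of_linCoeff_eq_zero (hgen : Function.Injective (algebraMap Fq[X] K))
    (φ : DrinfeldModule Fq K r) {u : QPoly Fq K} (hu : Commute u (φ.toRingHom X))
    (h0 : QPoly.linCoeff u = 0) : u = 0 := by
  refine QPoly.ext_coeff fun n => ?_
  rw [QPoly.poly_zero, coeff_zero]
  induction n using Nat.strong_induction_on with
  | _ n ih =>
    rcases Nat.eq_zero_or_pos n with rfl | hn
    · simpa [QPoly.linCoeff_apply] using h0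
    have h1 : (u * φ.toRingHom X).poly.coeff (Fintype.card Fq ^ n) =
        (φ.toRingHom X * u).poly.coeff (Fintype.card Fq ^ n) := by rw [hu.eq]
    rw [QPoly.coeff_mul, QPoly.coeff_mul,
      Finset.sum_eq_single n (fun i hi hin => by
        rw [ih i (by rw [Finset.mem_range] at hi; omega), zero_mul]) (by simp),
      Finset.sum_eq_single 0 (fun i hi hin => by
        rw [ih (n - i) (by omega), zero_pow (pow_ne_zero _ Fintype.card_ne_zero), mul_zero])
        (by simp)] at h1
    simp only [Nat.sub_self, pow_zero, pow_one, Nat.sub_zero, φ.coeff_one] at h1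
    by_contra hne
    rw [mul_comm] at h1
    exact algebraMap_X_pow_ne hgen hn.ne' (mul_right_cancel₀ hne h1)

theorem linCoeff_ne_zero_of_isHom (hgen : Function.Injective (algebraMap Fq[X] K))
    {φ : DrinfeldModule Fq K r} {f : QPoly Fq K} (hf : IsHom φ φ f) (h0 : f ≠ 0) :
    f.poly.coeff 1 ≠ 0 :=
  fun h => h0 (eq_zero_of_linCoeff_eq_zero hgen φ (hf X) h)

/-- An `(n)`-cyclic isogeny is separable with kernel `A / (n)`, so its degree is
`q ^ (deg n)`. -/
theorem natDegree_of_isCyclicIsogeny [IsAlgClosed K]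
    (hgen : Function.Injective (algebraMap Fq[X] K)) {n : Fq[X]} (hn : n.Monic)
    {φ : DrinfeldModule Fq K r} {f : QPoly Fq K} (hf : IsCyclicIsogeny n φ φ f) :
    f.poly.natDegree = Fintype.card Fq ^ n.natDegree := by
  classical
  obtain ⟨h0, hu, ⟨e⟩⟩ := hf
  have hsep := QPoly.separable_of_linCoeff_ne_zero (linCoeff_ne_zero_of_isHom hgen hu h0)
  have hp0 : f.poly ≠ 0 := hsep.ne_zero
  have h1 : Nat.card (ker hu) = f.poly.natDegree := by
    rw [← IsAlgClosed.card_roots_eq_natDegree, ← Multiset.toFinset_card_of_nodup (nodup_roots hsep)]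
    exact Nat.subtype_card (p := fun α : K => f.poly.eval α = 0) f.poly.roots.toFinset
      fun x => by simp [hp0]
  have : Module.Finite Fq (Fq[X] ⧸ Ideal.span {n}) :=
    hn.finite_quotient
  rw [← h1, Nat.card_congr e.toEquiv, Module.natCard_eq_pow_finrank (K := Fq),
    finrank_quotient_span_eq_natDegree, Nat.card_eq_fintype_card]

/-- No endomorphism `f` of degree `> 1` has its linear coefficient in a finite field, since
otherwise `f ^ (q ^ m) = f`. -/
theorem linCoeff_pow_ne (hgen : Function.Injective (algebraMap Fq[X] K))
    {φ : DrinfeldModule Fq K r} {f : QPoly Fq K} (hf : IsHom φ φ f)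
    (hdeg : 1 < f.poly.natDegree) {m : ℕ} (hm : m ≠ 0) :
    f.poly.coeff 1 ^ Fintype.card Fq ^ m ≠ f.poly.coeff 1 := by
  intro h
  have h1 : f ^ Fintype.card Fq ^ m - f = 0 := by
    refine eq_zero_of_linCoeff_eq_zero hgen φ ?_ ?_
    · exact ((show Commute f _ from hf X).pow_left _).sub_left (hf X)
    · rw [map_sub, map_pow, QPoly.linCoeff_apply, h, sub_self]
  have h2 := congrArg (fun u : QPoly Fq K => u.poly.natDegree) (sub_eq_zero.1 h1)
  simp only [QPoly.natDegree_poly_pow] at h2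
  exact (lt_self_pow₀ hdeg (Nat.one_lt_pow hm Fintype.one_lt_card)).ne' h2

end endomorphisms

/-! ### The centralizer of an endomorphism of degree `q ^ 2` in rank `3` -/

section relationPoly

variable {R : Type*} [CommRing R]

/-- The exponents `(i, j)` of the monomials `f ^ i φ_T ^ j` of degree at most `q ^ 8`. -/
def relationExponents : Finset (ℕ × ℕ) :=
  {k ∈ Finset.range 5 ×ˢ Finset.range 3 | 2 * k.1 + 3 * k.2 ≤ 8}

theorem card_relationExponents : relationExponents.card = 10 := by decide

/-- The polynomial `∑ c_ij T ^ j Y ^ i` in `A[Y]` over the exponents of degree at most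
`q ^ 8`. -/
noncomputable def relationPoly (c : relationExponents → R) : R[X][X] :=
  ∑ k, monomial k.1.1 (monomial k.1.2 (c k))

theorem coeff_relationPoly (c : relationExponents → R) (k : relationExponents) :
    ((relationPoly c).coeff k.1.1).coeff k.1.2 = c k := by
  rw [relationPoly, finsetSum_coeff, finsetSum_coeff, Finset.sum_eq_single k]
  · simp
  · rintro l - hl
    rw [coeff_monomial]
    split_ifs with h1
    · rw [coeff_monomial, if_neg fun h2 => hl (Subtype.ext (Prod.ext h1 h2))]
    · simp
  · simp

theorem relationPoly_sub (c d : relationExponents → R) :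
    relationPoly (c - d) = relationPoly c - relationPoly d := by
  simp [relationPoly, Finset.sum_sub_distrib]

theorem natDegree_relationPoly_le (c : relationExponents → R) :
    (relationPoly c).natDegree ≤ 4 := by
  refine natDegree_sum_le_of_forall_le _ _ fun k _ => (natDegree_monomial_le _).trans ?_
  have := k.2
  simp only [relationExponents, Finset.mem_filter, Finset.mem_product, Finset.mem_range] at this
  omega

end relationPoly

section centralizer

variable {Fq K : Type*} [Field Fq] [Fintype Fq] [Field K] [Algebra Fq[X] K]

theorem leadingCoeff_of_commute {f u : QPoly Fq K} {n : ℕ} (hf : f.poly.Monic)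
    (hdeg : f.poly.natDegree = Fintype.card Fq ^ n) (h : Commute u f) :
    u.poly.leadingCoeff ^ Fintype.card Fq ^ n = u.poly.leadingCoeff := by
  by_cases hu : u.poly.natDegree = 0
  · have h0 : u.poly = 0 := by
      rw [eq_C_of_natDegree_eq_zero hu, coeff_zero_eq_eval_zero, QPoly.eval_zero, C_0]
    rw [h0, leadingCoeff_zero, zero_pow (pow_ne_zero _ Fintype.card_ne_zero)]
  have h1 : (u * f).poly.leadingCoeff = (f * u).poly.leadingCoeff := by rw [h.eq]
  rw [QPoly.poly_mul, QPoly.poly_mul, leadingCoeff_comp hu, leadingCoeff_comp (by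
    rw [hdeg]; exact pow_ne_zero _ Fintype.card_ne_zero), hf.leadingCoeff, one_pow, mul_one,
    one_mul, hdeg] at h1
  exact h1.symm

theorem leadingCoeff_of_commute_toRingHom {φ : DrinfeldModule Fq K 3} {f u : QPoly Fq K}
    (hf : f.poly.Monic) (hdeg : f.poly.natDegree = Fintype.card Fq ^ 2) (hu : u ≠ 0)
    (h : Commute u f) (h' : Commute u (φ.toRingHom X)) :
    φ.g 3 * u.poly.leadingCoeff ^ Fintype.card Fq =
      φ.g 3 ^ u.poly.natDegree * u.poly.leadingCoeff := by
  have hu0 : u.poly.natDegree ≠ 0 := by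
    obtain ⟨i, hi⟩ := QPoly.exists_natDegree_eq_pow hu
    rw [hi]
    exact pow_ne_zero _ Fintype.card_ne_zero
  have h1 : (u * φ.toRingHom X).poly.leadingCoeff = (φ.toRingHom X * u).poly.leadingCoeff := by
    rw [h'.eq]
  rw [QPoly.poly_mul, QPoly.poly_mul, leadingCoeff_comp hu0, leadingCoeff_comp (by
    rw [φ.natDegree_eq]; exact pow_ne_zero _ Fintype.card_ne_zero), ← g_rank_eq_leadingCoeff,
    φ.natDegree_eq, pow_succ, pow_mul, leadingCoeff_of_commute hf hdeg h] at h1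
  rw [← h1, mul_comm]

/-- There are at most `q ^ d` endomorphisms of `φ` of degree `< q ^ d` that commute with `f`:
their coefficients at `x ^ (q ^ d)` lie in a line over `Fq`, cut out by a polynomial of degree
`q`. -/
theorem card_commute_le {φ : DrinfeldModule Fq K 3} {f : QPoly Fq K}
    (hf : f.poly.Monic) (hdeg : f.poly.natDegree = Fintype.card Fq ^ 2) (d : ℕ)
    (S : Finset (QPoly Fq K)) (hS : ∀ u ∈ S, Commute u f ∧ Commute u (φ.toRingHom X) ∧
      u.poly.natDegree < Fintype.card Fq ^ d) : S.card ≤ Fintype.card Fq ^ d := by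
  classical
  induction d generalizing S with
  | zero =>
    rw [pow_zero, Finset.card_le_one]
    have h0 : ∀ u ∈ S, u = 0 := fun u hu => by
      by_contra hne
      obtain ⟨i, hi⟩ := QPoly.exists_natDegree_eq_pow hne
      have := (hS u hu).2.2
      rw [hi, pow_zero, Nat.lt_one_iff] at this
      exact pow_ne_zero _ Fintype.card_ne_zero this
    intro u hu v hv
    rw [h0 u hu, h0 v hv]
  | succ d ih =>
    have hq : 1 < Fintype.card Fq := Fintype.one_lt_card
    set P : K[X] := C (φ.g 3) * X ^ Fintype.card Fq - C (φ.g 3 ^ Fintype.card Fq ^ d) * X ^ 1 with hP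
    have hPdeg : P.natDegree ≤ Fintype.card Fq := by
      rw [hP]
      refine (natDegree_sub_le_of_le (natDegree_C_mul_X_pow_le _ _)
        (natDegree_C_mul_X_pow_le _ _)).trans ?_
      simpa using hq.le
    have hP0 : P ≠ 0 := by
      intro h
      have := congrArg (fun p : K[X] => p.coeff (Fintype.card Fq)) h
      rw [hP, coeff_sub, coeff_C_mul, coeff_C_mul, coeff_X_pow_self, coeff_X_pow, if_neg hq.ne',
        mul_one, mul_zero, sub_zero, coeff_zero] at this
      exact φ.g_rank_ne_zero this
    have hmaps : ∀ u ∈ S, u.poly.coeff (Fintype.card Fq ^ d) ∈ P.roots.toFinset := by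
      intro u hu
      obtain ⟨h1, h2, h3⟩ := hS u hu
      rw [Multiset.mem_toFinset, mem_roots hP0, IsRoot, hP]
      by_cases h0 : u.poly.coeff (Fintype.card Fq ^ d) = 0
      · simp [h0]
      have hn : u.poly.natDegree = Fintype.card Fq ^ d := by
        obtain ⟨i, hi⟩ := QPoly.exists_natDegree_eq_pow (u := u) (by rintro rfl; simp at h0)
        have h4 := le_natDegree_of_ne_zero h0
        rw [hi] at h3 h4 ⊢
        rw [Nat.pow_lt_pow_iff_right hq] at h3
        rw [Nat.pow_le_pow_iff_right hq] at h4
        rw [show i = d by omega]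
      have := leadingCoeff_of_commute_toRingHom hf hdeg (by rintro rfl; simp at h0) h1 h2
      rw [leadingCoeff, hn] at this
      simp [this]
    refine (Finset.card_le_mul_card_image_of_maps_to hmaps (Fintype.card Fq ^ d) ?_).trans ?_
    · intro l _
      rcases Finset.eq_empty_or_nonempty {u ∈ S | u.poly.coeff (Fintype.card Fq ^ d) = l} with
        h | ⟨v, hv⟩
      · simp [h]
      rw [Finset.mem_filter] at hv
      obtain ⟨hv, hvl⟩ := hv
      -- Two elements of a fibre differ by an endomorphism of degree `< q ^ d`.
      rw [← Finset.card_image_of_injective _ (sub_left_injective (b := v))]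
      refine ih _ ?_
      simp only [Finset.mem_image, Finset.mem_filter]
      rintro _ ⟨u, ⟨hu, hul⟩, rfl⟩
      obtain ⟨h1, h2, h3⟩ := hS u hu
      obtain ⟨h1', h2', h3'⟩ := hS v hv
      refine ⟨h1.sub_left h1', h2.sub_left h2', QPoly.natDegree_lt_of_coeff_eq_zero ?_ ?_⟩
      · rw [QPoly.poly_sub]
        exact (natDegree_sub_le _ _).trans_lt (max_lt h3 h3')
      · rw [QPoly.poly_sub, coeff_sub, hul, hvl, sub_self]
    · rw [pow_succ]
      exact Nat.mul_le_mul_left _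
        ((Multiset.toFinset_card_le _).trans ((card_roots' _).trans hPdeg))

/-- The possible linear coefficients of monic endomorphisms of degree `q ^ 2`: the roots of the
nonzero polynomials `∑ c_ij T ^ j Y ^ i`. -/
noncomputable def linCoeffCandidates (Fq K : Type*) [Field Fq] [Fintype Fq] [Field K]
    [Algebra Fq[X] K] : Finset K := by
  classical
  exact (Finset.univ.filter fun c : relationExponents → Fq => c ≠ 0).biUnion fun c =>
    ((relationPoly c).map (algebraMap Fq[X] K)).roots.toFinset

theorem card_linCoeffCandidates_le :
    (linCoeffCandidates Fq K).card ≤ Fintype.card Fq ^ 10 * 4 := by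
  classical
  refine (Finset.card_biUnion_le_card_mul _ _ 4 fun c _ => ?_).trans
    (Nat.mul_le_mul_right _ ((Finset.card_le_univ _).trans ?_))
  · exact (Multiset.toFinset_card_le _).trans ((card_roots' _).trans
      (natDegree_map_le.trans (natDegree_relationPoly_le c)))
  · rw [Fintype.card_fun, Fintype.card_coe, card_relationExponents]

/-- The ten monomials `f ^ i φ_T ^ j` with `2 i + 3 j ≤ 8` have `q ^ 10` combinations over `Fq`,
which commute with `f` and `φ_T` and have degree less than `q ^ 9`; so two of them agree. -/
theorem coeff_one_mem_linCoeffCandidates (hgen : Function.Injective (algebraMap Fq[X] K))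
    {φ : DrinfeldModule Fq K 3} {f : QPoly Fq K} (hφ : IsHom φ φ f)
    (hf : f.poly.Monic) (hdeg : f.poly.natDegree = Fintype.card Fq ^ 2) :
    f.poly.coeff 1 ∈ linCoeffCandidates Fq K := by
  classical
  have hq : 1 < Fintype.card Fq := Fintype.one_lt_card
  let L : (relationExponents → Fq) → QPoly Fq K := fun c =>
    (relationPoly c).eval₂ φ.toRingHom f
  have hL : ∀ c, L c = ∑ k, φ.toRingHom (monomial k.1.2 (c k)) * f ^ k.1.1 := fun c => by
    simp only [L, relationPoly, eval₂_finsetSum, eval₂_monomial]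
  have hcard : ¬ Function.Injective L := by
    intro hinj
    have h1 := card_commute_le hf hdeg 9 (φ := φ) (Finset.univ.image L) (by
      simp only [Finset.mem_image, Finset.mem_univ, true_and]
      rintro _ ⟨c, rfl⟩
      rw [hL]
      refine ⟨Commute.sum_left _ _ _ fun k _ => ?_, Commute.sum_left _ _ _ fun k _ => ?_, ?_⟩
      · exact (show Commute f _ from hφ _).symm.mul_left ((Commute.refl f).pow_left _)
      · exact ((Commute.all _ _).map φ.toRingHom).mul_left
          ((show Commute f _ from hφ _).pow_left _)
      · rw [QPoly.poly_sum]
        refine (natDegree_sum_le_of_forall_le (n := Fintype.card Fq ^ 8) _ _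
          fun k _ => ?_).trans_lt (Nat.pow_lt_pow_right hq (by omega))
        rw [QPoly.poly_mul, natDegree_comp, QPoly.natDegree_poly_pow, hdeg, ← pow_mul]
        refine (Nat.mul_le_mul_right _ (natDegree_toRingHom_monomial_le φ _ _)).trans ?_
        rw [← pow_add]
        refine Nat.pow_le_pow_right hq.le ?_
        have := k.2
        simp only [relationExponents, Finset.mem_filter] at this
        omega)
    rw [Finset.card_image_of_injective _ hinj, Finset.card_univ, Fintype.card_fun,
      Fintype.card_coe, card_relationExponents, Nat.pow_le_pow_iff_right hq] at h1
    omega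
  obtain ⟨c, d, hcd, hne⟩ : ∃ c d, L c = L d ∧ c ≠ d := by
    simpa [Function.Injective] using hcard
  have h0 : relationPoly (c - d) ≠ 0 := by
    intro h
    refine sub_ne_zero.2 hne (funext fun k => ?_)
    rw [← coeff_relationPoly (c - d) k, h]
    simp
  simp only [linCoeffCandidates, Finset.mem_biUnion, Finset.mem_filter, Finset.mem_univ, true_and,
    Multiset.mem_toFinset]
  refine ⟨c - d, sub_ne_zero.2 hne, ?_⟩
  rw [mem_roots ((Polynomial.map_ne_zero_iff hgen).2 h0), IsRoot, eval_map,
    ← φ.linCoeff_comp_toRingHom, ← QPoly.linCoeff_apply, ← hom_eval₂, relationPoly_sub, eval₂_sub]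
  rw [show eval₂ φ.toRingHom f (relationPoly c) = eval₂ φ.toRingHom f (relationPoly d) from hcd,
    sub_self, map_zero]

end centralizer

/-! ### Counting pairs `(φ, f)` with `f` monic of degree `q ^ 2` -/

section counting

variable {Fq K : Type*} [Field Fq] [Fintype Fq] [Field K]

/-- With `φ_T = T + g₁ τ + g₂ τ² + g₃ τ³` and `f = a + b τ + τ²`, the `τ`-coefficient of
`f φ_T = φ_T f` says that `b` is this multiple of `g₁`. -/
noncomputable def bFactor (q : ℕ) (T a : K) : K := (a ^ q - a) / (T ^ q - T)

/-- The expression of `g₂` as a polynomial in `g₁` given by the `τ²`-coefficient of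
`f φ_T = φ_T f`. -/
noncomputable def gTwoPoly (q : ℕ) (T a : K) : K[X] :=
  C ((T ^ q ^ 2 - T) / (a ^ q ^ 2 - a)) +
    C ((bFactor q T a - bFactor q T a ^ q) / (a ^ q ^ 2 - a)) * X ^ (q + 1)

/-- The equation for `g₁` given by the `τ³`-coefficient of `f φ_T = φ_T f`, after elimination of
`b` and `g₂`. -/
noncomputable def gOnePoly (q : ℕ) (T a g₃ : K) : K[X] :=
  C (g₃ * (a - a ^ q ^ 3)) + C (bFactor q T a) * X * gTwoPoly q T a ^ q + X ^ q ^ 2 - X -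
    gTwoPoly q T a * C (bFactor q T a ^ q ^ 2) * X ^ q ^ 2

theorem natDegree_gTwoPoly_le (q : ℕ) (T a : K) : (gTwoPoly q T a).natDegree ≤ q + 1 :=
  (natDegree_add_le_of_degree_le (n := q + 1) ((natDegree_C _).trans_le (Nat.zero_le _))
    (natDegree_C_mul_X_pow_le _ _))

theorem natDegree_gOnePoly_le (q : ℕ) (T a g₃ : K) :
    (gOnePoly q T a g₃).natDegree ≤ q ^ 2 + q + 1 := by
  have h2 := natDegree_gTwoPoly_le q T a
  have hsub {u v : K[X]} {m : ℕ} (hu : u.natDegree ≤ m) (hv : v.natDegree ≤ m) :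
      (u - v).natDegree ≤ m := (natDegree_sub_le u v).trans (max_le hu hv)
  refine hsub (hsub (natDegree_add_le_of_degree_le
    (natDegree_add_le_of_degree_le ?_ ?_) ?_) ?_) ?_
  · exact (natDegree_C _).trans_le (Nat.zero_le _)
  · refine natDegree_mul_le.trans ((add_le_add (natDegree_C_mul_le _ _)
      (natDegree_pow_le_of_le q h2)).trans ?_)
    rw [natDegree_X]
    linarith [sq q, mul_add q q 1]
  · rw [natDegree_X_pow]
    omega
  · rw [natDegree_X]
    omega
  · refine natDegree_mul_le.trans ((add_le_add ((natDegree_mul_C_le _ _).trans h2)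
      (natDegree_X_pow_le _)).trans ?_)
    omega

/-- The constant term `g₃ (a - a ^ (q ^ 3))` does not vanish. -/
theorem gOnePoly_ne_zero {q : ℕ} (hq : q ≠ 0) {T a g₃ : K} (hg : g₃ ≠ 0)
    (ha : a ^ q ^ 3 ≠ a) : gOnePoly q T a g₃ ≠ 0 := by
  intro h
  have := congrArg (eval 0) h
  simp [gOnePoly, hq, hg, sub_eq_zero, ha.symm] at this

theorem coeff_eq_zero_of_natDegree_eq {f : QPoly Fq K} {m i : ℕ}
    (hdeg : f.poly.natDegree = Fintype.card Fq ^ m) (hi : m < i) :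
    f.poly.coeff (Fintype.card Fq ^ i) = 0 := by
  refine coeff_eq_zero_of_natDegree_lt ?_
  rw [hdeg]
  exact Nat.pow_lt_pow_right Fintype.one_lt_card hi

variable [Algebra Fq[X] K]

/-- The pairs `(φ, f)` of a rank `3` Drinfeld module and a monic endomorphism of degree
`q ^ 2`. -/
def monicEndPairs (Fq K : Type*) [Field Fq] [Fintype Fq] [Field K] [Algebra Fq[X] K] :
    Set (DrinfeldModule Fq K 3 × QPoly Fq K) :=
  {x | IsHom x.1 x.1 x.2 ∧ x.2.poly.Monic ∧ x.2.poly.natDegree = Fintype.card Fq ^ 2}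

/-- The coefficients of `f φ_T = φ_T f` at `x ^ (q ^ n)`. -/
theorem sum_eq_of_isHom {φ : DrinfeldModule Fq K 3} {f : QPoly Fq K} (hf : IsHom φ φ f) (n : ℕ) :
    ∑ i ∈ Finset.range (n + 1), f.poly.coeff (Fintype.card Fq ^ i) *
        φ.g (n - i) ^ Fintype.card Fq ^ i =
      ∑ i ∈ Finset.range (n + 1), φ.g i *
        f.poly.coeff (Fintype.card Fq ^ (n - i)) ^ Fintype.card Fq ^ i := by
  have h : (f * φ.toRingHom X).poly.coeff (Fintype.card Fq ^ n) =
      (φ.toRingHom X * f).poly.coeff (Fintype.card Fq ^ n) := by rw [hf X]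
  rwa [QPoly.coeff_mul, QPoly.coeff_mul] at h

variable (hgen : Function.Injective (algebraMap Fq[X] K))
include hgen

theorem coeff_card_of_mem_monicEndPairs {φ : DrinfeldModule Fq K 3} {f : QPoly Fq K}
    (h : (φ, f) ∈ monicEndPairs Fq K) :
    f.poly.coeff (Fintype.card Fq) =
      bFactor (Fintype.card Fq) (algebraMap Fq[X] K X) (f.poly.coeff 1) * φ.g 1 := by
  have h1 := sum_eq_of_isHom h.1 1
  simp only [Finset.sum_range_succ, Finset.range_zero, Finset.sum_empty, φ.g_zero, Nat.sub_self,
    Nat.sub_zero, pow_zero, pow_one, zero_add] at h1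
  have hT := algebraMap_X_pow_ne hgen one_ne_zero
  rw [pow_one] at hT
  rw [bFactor, div_mul_eq_mul_div, eq_div_iff (sub_ne_zero.2 hT)]
  linear_combination h1

theorem g_two_of_mem_monicEndPairs {φ : DrinfeldModule Fq K 3} {f : QPoly Fq K}
    (h : (φ, f) ∈ monicEndPairs Fq K) :
    φ.g 2 = (gTwoPoly (Fintype.card Fq) (algebraMap Fq[X] K X) (f.poly.coeff 1)).eval (φ.g 1) := by
  have h2 := sum_eq_of_isHom h.1 2
  have hlc : f.poly.coeff (Fintype.card Fq ^ 2) = 1 := h.2.2 ▸ h.2.1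
  simp only [Finset.sum_range_succ, Finset.range_zero, Finset.sum_empty, φ.g_zero, Nat.sub_self,
    Nat.sub_zero, pow_zero, pow_one, zero_add, hlc, Nat.reduceSub,
    coeff_card_of_mem_monicEndPairs hgen h] at h2
  have ha := linCoeff_pow_ne hgen h.1
    (by rw [h.2.2]; exact Nat.one_lt_pow two_ne_zero Fintype.one_lt_card) two_ne_zero
  simp only [gTwoPoly, eval_add, eval_mul, eval_C, eval_pow, eval_X]
  rw [div_mul_eq_mul_div, ← add_div, eq_div_iff (sub_ne_zero.2 ha)]
  linear_combination -h2

theorem eval_gOnePoly_of_mem_monicEndPairs {φ : DrinfeldModule Fq K 3} {f : QPoly Fq K}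
    (h : (φ, f) ∈ monicEndPairs Fq K) :
    (gOnePoly (Fintype.card Fq) (algebraMap Fq[X] K X) (f.poly.coeff 1) (φ.g 3)).eval (φ.g 1) =
      0 := by
  have h3 := sum_eq_of_isHom h.1 3
  have hlc : f.poly.coeff (Fintype.card Fq ^ 2) = 1 := h.2.2 ▸ h.2.1
  have hf3 := coeff_eq_zero_of_natDegree_eq h.2.2 (i := 3) (by omega)
  simp only [Finset.sum_range_succ, Finset.range_zero, Finset.sum_empty, φ.g_zero, Nat.sub_self,
    Nat.sub_zero, pow_zero, pow_one, zero_add, hlc, hf3, Nat.reduceSub, one_pow,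
    coeff_card_of_mem_monicEndPairs hgen h, g_two_of_mem_monicEndPairs hgen h] at h3
  simp only [gOnePoly, eval_add, eval_sub, eval_mul, eval_C, eval_pow, eval_X]
  linear_combination h3

theorem eq_of_mem_monicEndPairs {φ ψ : DrinfeldModule Fq K 3} {f g : QPoly Fq K}
    (h : (φ, f) ∈ monicEndPairs Fq K) (h' : (ψ, g) ∈ monicEndPairs Fq K)
    (ha : f.poly.coeff 1 = g.poly.coeff 1) (h3 : φ.g 3 = ψ.g 3) (h1 : φ.g 1 = ψ.g 1) :
    (φ, f) = (ψ, g) := by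
  refine Prod.ext (ext_of_g fun i => ?_) (QPoly.ext_coeff fun i => ?_)
  · match i with
    | 0 => rw [g_zero, g_zero]
    | 1 => exact h1
    | 2 => rw [g_two_of_mem_monicEndPairs hgen h, g_two_of_mem_monicEndPairs hgen h', ha, h1]
    | 3 => exact h3
    | i + 4 => rw [g_eq_zero_of_lt _ (by omega), g_eq_zero_of_lt _ (by omega)]
  · match i with
    | 0 => simpa using ha
    | 1 =>
      rw [pow_one, coeff_card_of_mem_monicEndPairs hgen h,
        coeff_card_of_mem_monicEndPairs hgen h', ha, h1]
    | 2 =>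
      rw [show f.poly.coeff _ = 1 from h.2.2 ▸ h.2.1,
        show g.poly.coeff _ = 1 from h'.2.2 ▸ h'.2.1]
    | i + 3 =>
      rw [coeff_eq_zero_of_natDegree_eq h.2.2 (by omega),
        coeff_eq_zero_of_natDegree_eq h'.2.2 (by omega)]

/-- A pair `(φ, f)` is determined by `(a, g₃, g₁)`, and there are at most `4 q ^ 10` values of
`a`, then `q ^ 2` values of `g₃`, then `q ^ 2 + q + 1` values of `g₁`. -/
theorem finite_and_ncard_monicEndPairs_le :
    (monicEndPairs Fq K).Finite ∧ (monicEndPairs Fq K).ncard ≤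
      Fintype.card Fq ^ 10 * 4 * Fintype.card Fq ^ 2 *
        (Fintype.card Fq ^ 2 + Fintype.card Fq + 1) := by
  classical
  have hq : 1 < Fintype.card Fq := Fintype.one_lt_card
  have hq2 : 1 < Fintype.card Fq ^ 2 := Nat.one_lt_pow two_ne_zero hq
  let t : Finset ((_ : K × K) × K) :=
    (linCoeffCandidates Fq K ×ˢ (X ^ Fintype.card Fq ^ 2 - X : K[X]).roots.toFinset).sigma
      fun x => (gOnePoly (Fintype.card Fq) (algebraMap Fq[X] K X) x.1 x.2).roots.toFinset
  have ht : t.card ≤ Fintype.card Fq ^ 10 * 4 * Fintype.card Fq ^ 2 *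
      (Fintype.card Fq ^ 2 + Fintype.card Fq + 1) := by
    rw [Finset.card_sigma]
    refine (Finset.sum_le_card_nsmul _ _ (Fintype.card Fq ^ 2 + Fintype.card Fq + 1)
      fun x _ => ?_).trans ?_
    · exact (Multiset.toFinset_card_le _).trans
        ((card_roots' _).trans (natDegree_gOnePoly_le _ _ _ _))
    · rw [smul_eq_mul, Finset.card_product]
      refine Nat.mul_le_mul_right _ (Nat.mul_le_mul card_linCoeffCandidates_le ?_)
      exact (Multiset.toFinset_card_le _).trans
        ((card_roots' _).trans (FiniteField.X_pow_card_sub_X_natDegree_eq K hq2).le)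
  let F : DrinfeldModule Fq K 3 × QPoly Fq K → (_ : K × K) × K :=
    fun x => ⟨(x.2.poly.coeff 1, x.1.g 3), x.1.g 1⟩
  have hmaps : Set.MapsTo F (monicEndPairs Fq K) t := by
    rintro ⟨φ, f⟩ h
    have ha := linCoeff_pow_ne hgen h.1 (by rw [h.2.2]; exact hq2) three_ne_zero
    have hg := leadingCoeff_of_commute h.2.1 h.2.2 (h.1 X).symm
    rw [← g_rank_eq_leadingCoeff] at hg
    simp only [t, F, Finset.coe_sigma, Set.mem_sigma_iff, Finset.mem_coe, Finset.mem_product,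
      Multiset.mem_toFinset]
    refine ⟨⟨coeff_one_mem_linCoeffCandidates hgen h.1 h.2.1 h.2.2, ?_⟩, ?_⟩
    · rw [mem_roots (FiniteField.X_pow_card_sub_X_ne_zero K hq2)]
      simp [hg]
    · rw [mem_roots (gOnePoly_ne_zero Fintype.card_ne_zero φ.g_rank_ne_zero ha)]
      exact eval_gOnePoly_of_mem_monicEndPairs hgen h
  have hinj : Set.InjOn F (monicEndPairs Fq K) := by
    rintro ⟨φ, f⟩ h ⟨ψ, g⟩ h' he
    simp only [F, Sigma.mk.injEq, Prod.mk.injEq, heq_eq_eq] at he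
    exact eq_of_mem_monicEndPairs hgen h h' he.1.1 he.1.2 he.2
  refine ⟨Set.Finite.of_injOn hmaps hinj t.finite_toSet, ?_⟩
  refine (Set.ncard_le_ncard_of_injOn F hmaps hinj t.finite_toSet).trans ?_
  rwa [Set.ncard_coe_finset]

theorem ncard_monicEndPairs_le_boundN :
    ((monicEndPairs Fq K).ncard : ℤ) ≤ boundN (Fintype.card Fq) := by
  have h : ((monicEndPairs Fq K).ncard : ℤ) ≤ (Fintype.card Fq : ℤ) ^ 10 * 4 *
      (Fintype.card Fq : ℤ) ^ 2 * ((Fintype.card Fq : ℤ) ^ 2 + Fintype.card Fq + 1) := by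
    exact_mod_cast (finite_and_ncard_monicEndPairs_le hgen).2
  refine h.trans ?_
  have hq : (2 : ℤ) ≤ Fintype.card Fq := by exact_mod_cast Fintype.one_lt_card (α := Fq)
  generalize (Fintype.card Fq : ℤ) = q at hq
  have h1 : 0 ≤ q ^ 8 := by positivity
  have h2 : q + 1 ≤ q ^ 2 := by nlinarith
  have h3 : 8 ≤ (q ^ 3 + 1) * (q ^ 2 - 1) := by nlinarith [pow_le_pow_left₀ (by norm_num) hq 3]
  have h4 : q ^ 14 ≤
      30 * q ^ 15 - 4 * q ^ 14 + q ^ 12 + 2 * q ^ 11 - q ^ 10 - 2 * q ^ 9 - q ^ 8 := by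
    have h5 : 0 ≤ q ^ 6 * (30 * q - 5) + (q ^ 4 - q ^ 2) + 2 * (q ^ 3 - q) - 1 := by
      have a1 : 1 ≤ q ^ 6 := one_le_pow₀ (by linarith)
      have a2 : q ^ 2 ≤ q ^ 4 := pow_le_pow_right₀ (by linarith) (by norm_num)
      have a3 : q ^ 1 ≤ q ^ 3 := pow_le_pow_right₀ (by linarith) (by norm_num)
      nlinarith
    nlinarith [mul_nonneg h1 h5]
  -- The count is at most `8 q ^ 14`, far below `boundN q`, whose leading term is `30 q ^ 20`.
  calc q ^ 10 * 4 * q ^ 2 * (q ^ 2 + q + 1) ≤ q ^ 10 * 4 * q ^ 2 * (q ^ 2 + q ^ 2) := by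
        refine mul_le_mul_of_nonneg_left (by linarith) (by positivity)
    _ = 8 * q ^ 14 := by ring
    _ ≤ boundN q := mul_le_mul h3 h4 (by positivity) (by linarith)

end counting

/-! ### Isomorphism classes and modular polynomials -/

section classes

variable {Fq K : Type*} [Field Fq] [Fintype Fq] [Field K] [Algebra Fq[X] K] {r : ℕ}

theorem natDegree_conj (u : (QPoly Fq K)ˣ) (f : QPoly Fq K) :
    ((↑u⁻¹ : QPoly Fq K) * f * u).poly.natDegree = f.poly.natDegree := by
  have h : ∀ v : (QPoly Fq K)ˣ, (v : QPoly Fq K).poly.natDegree = 1 := fun v => by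
    obtain ⟨c, hc, hv⟩ := QPoly.exists_unit_eq v
    rw [hv, QPoly.poly_scal, natDegree_C_mul hc, natDegree_X]
  simp [natDegree_comp, h]

/-- The Drinfeld module `u⁻¹ φ u` isomorphic to `φ`, for a unit `u`. -/
noncomputable def conj (φ : DrinfeldModule Fq K r) (u : (QPoly Fq K)ˣ) :
    DrinfeldModule Fq K r where
  toRingHom :=
    { toFun := fun a => (↑u⁻¹ : QPoly Fq K) * φ.toRingHom a * u
      map_one' := by simp
      map_mul' := fun a b => by simp [mul_assoc]
      map_zero' := by simp
      map_add' := fun a b => by simp [mul_add, add_mul] }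
  map_const c := by
    obtain ⟨d, -, hd⟩ := QPoly.exists_unit_eq u
    change (↑u⁻¹ : QPoly Fq K) * φ.toRingHom (C c) * u = _
    rw [φ.map_const, mul_assoc, Units.inv_mul_eq_iff_eq_mul, hd]
    refine QPoly.ext ?_
    simp only [QPoly.poly_mul, QPoly.poly_scal, mul_comp, C_comp, X_comp]
    ring
  coeff_one := by
    change QPoly.linCoeff ((↑u⁻¹ : QPoly Fq K) * φ.toRingHom X * (u : QPoly Fq K)) = _
    rw [map_mul, map_mul, mul_right_comm, ← map_mul, Units.inv_mul, map_one, one_mul]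
    exact φ.coeff_one
  natDegree_eq := (natDegree_conj u _).trans φ.natDegree_eq

theorem conj_toRingHom (φ : DrinfeldModule Fq K r) (u : (QPoly Fq K)ˣ) (a : Fq[X]) :
    (φ.conj u).toRingHom a = (↑u⁻¹ : QPoly Fq K) * φ.toRingHom a * (u : QPoly Fq K) := rfl

/-- The unit `c x`. -/
noncomputable def scalUnit (Fq : Type*) {K : Type*} [Field Fq] [Fintype Fq] [Field K]
    [Algebra Fq[X] K] (c : Kˣ) : (QPoly Fq K)ˣ where
  val := QPoly.scal c
  inv := QPoly.scal (c⁻¹ : Kˣ)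
  val_inv := QPoly.ext (by simp [QPoly.poly_scal, ← mul_assoc, ← C_mul])
  inv_val := QPoly.ext (by simp [QPoly.poly_scal, ← mul_assoc, ← C_mul])

/-- Over an algebraically closed field every nonlinear `f` has a monic conjugate `c⁻¹ f c`: its
leading coefficient is that of `f` multiplied by `c ^ (deg f - 1)`. -/
theorem exists_conj_monic [IsAlgClosed K] {f : QPoly Fq K} (hf : 1 < f.poly.natDegree) :
    ∃ u : (QPoly Fq K)ˣ, ((↑u⁻¹ : QPoly Fq K) * f * u).poly.Monic := by
  have hl : f.poly.leadingCoeff ≠ 0 := by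
    rw [leadingCoeff_ne_zero]
    rintro h
    simp [h] at hf
  obtain ⟨c, hc⟩ := IsAlgClosed.exists_pow_nat_eq f.poly.leadingCoeff⁻¹ (Nat.sub_pos_of_lt hf)
  have hc0 : c ≠ 0 := by
    rintro rfl
    rw [zero_pow (Nat.sub_pos_of_lt hf).ne'] at hc
    exact inv_ne_zero hl hc.symm
  refine ⟨scalUnit Fq (Units.mk0 c hc0), ?_⟩
  change (((C _ * X : K[X]).comp f.poly).comp (C c * X)).leadingCoeff = 1
  rw [leadingCoeff_comp (by rw [natDegree_C_mul hc0, natDegree_X]; exact one_ne_zero)]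
  simp only [mul_comp, C_comp, X_comp, leadingCoeff_mul, leadingCoeff_C, leadingCoeff_X, mul_one]
  rw [natDegree_C_mul (Units.ne_zero _), ← Nat.sub_add_cancel hf.le, pow_succ, hc]
  rw [Units.val_inv_eq_inv_val, Units.val_mk0]
  field_simp

theorem natDegree_finprod_X_sub_C_le {ι : Type*} [Finite ι] (v : ι → K) :
    (∏ᶠ i, (X - C (v i))).natDegree ≤ Nat.card ι := by
  have := Fintype.ofFinite ι
  rw [finprod_eq_prod_of_fintype, natDegree_prod_of_monic _ _ fun i _ => monic_X_sub_C _]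
  simp

theorem mem_monicEndPairs [IsAlgClosed K] (hgen : Function.Injective (algebraMap Fq[X] K))
    {n : Fq[X]} (hn : n.Monic) (hdeg : n.natDegree = 2) {φ : DrinfeldModule Fq K 3}
    {f : QPoly Fq K} (hf : IsCyclicIsogeny n φ φ f) (hm : f.poly.Monic) :
    (φ, f) ∈ monicEndPairs Fq K :=
  ⟨hf.2.choose, hm, hdeg ▸ natDegree_of_isCyclicIsogeny hgen hn hf⟩

theorem exists_iso_mem_monicEndPairs [IsAlgClosed K]
    (hgen : Function.Injective (algebraMap Fq[X] K))
    {n : Fq[X]} (hn : n.Monic) (hdeg : n.natDegree = 2) {φ : DrinfeldModule Fq K 3}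
    {f : QPoly Fq K} (hf : IsCyclicIsogeny n φ φ f) :
    ∃ x ∈ monicEndPairs Fq K, isoSetoid Fq K 3 x.1 φ := by
  have h1 : f.poly.natDegree = Fintype.card Fq ^ 2 :=
    hdeg ▸ natDegree_of_isCyclicIsogeny hgen hn hf
  have h2 : 1 < f.poly.natDegree := by
    rw [h1]
    exact Nat.one_lt_pow two_ne_zero Fintype.one_lt_card
  -- Only the degree of the conjugate of `f` matters, so its kernel need not be followed.
  obtain ⟨u, hu⟩ := exists_conj_monic h2
  refine ⟨(φ.conj u, ↑u⁻¹ * f * u), ⟨fun a => ?_, hu, (natDegree_conj u f).trans h1⟩,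
    u, fun a => ?_⟩
  · have h3 := hf.2.choose a
    simp only [conj_toRingHom, mul_assoc, Units.mul_inv_cancel_left]
    rw [← mul_assoc f, h3, mul_assoc]
  · rw [conj_toRingHom, mul_assoc, Units.mul_inv_cancel_left]

end classes

end DrinfeldModule
end Drinfeld

theorem mainTheorem8 {Fq K : Type*} [Field Fq] [Fintype Fq] (p : ℕ) [CharP Fq p] (hp : 3 < p)
    [Field K] [IsAlgClosed K] [Algebra Fq[X] K]
    (hgen : Function.Injective (algebraMap Fq[X] K)) :
    let q : ℤ := Fintype.card Fq
    let a : Fq[X] := X ^ 2 + X + 1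
    let admitsMonic : Set (Drinfeld.DrinfeldModule Fq K 3) :=
      {φ | ∃ f, Drinfeld.DrinfeldModule.IsCyclicIsogeny a φ φ f ∧ f.poly.Monic}
    let isoClasses : Set (Quotient (Drinfeld.DrinfeldModule.isoSetoid Fq K 3)) :=
      {c | ∃ φ, Quotient.mk _ φ = c ∧ ∃ f, Drinfeld.DrinfeldModule.IsCyclicIsogeny a φ φ f}
    (admitsMonic.Finite ∧ (admitsMonic.ncard : ℤ) ≤ Drinfeld.boundN q) ∧
    (isoClasses.Finite ∧ (isoClasses.ncard : ℤ) ≤ Drinfeld.boundN q) ∧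
    (Finite (Quotient (Drinfeld.DrinfeldModule.copySetoid K 3 a)) ∧
      ∀ J : Drinfeld.DrinfeldModule.Invariant Fq K 3,
        ((Drinfeld.DrinfeldModule.selfModularPoly J a).natDegree : ℤ) ≤ Drinfeld.boundN q) ∧
    (Finite (Quotient (Drinfeld.DrinfeldModule.conjSetoid K 3 a)) ∧
      ∀ J : Drinfeld.DrinfeldModule.Invariant Fq K 3,
        ((Drinfeld.DrinfeldModule.selfModularPolyConj J a).natDegree : ℤ) ≤
          Drinfeld.boundN q) := by
  intro q a admitsMonic isoClasses
  have ha : a.natDegree = 2 := by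
    simp only [a]
    compute_degree!
  have ham : a.Monic := by
    simp only [a]
    monicity!
  have hfin := (Drinfeld.DrinfeldModule.finite_and_ncard_monicEndPairs_le hgen).1
  have hcard := Drinfeld.DrinfeldModule.ncard_monicEndPairs_le_boundN hgen
  -- Every set or quotient in the statement is bounded through a map from the pairs `(φ, f)`.
  have hsub : ∀ {α : Type _} (F : Drinfeld.DrinfeldModule Fq K 3 × Drinfeld.QPoly Fq K → α)
      (S : Set α), S ⊆ F '' Drinfeld.DrinfeldModule.monicEndPairs Fq K →
      S.Finite ∧ (S.ncard : ℤ) ≤ Drinfeld.boundN q := fun F S h =>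
    ⟨(hfin.image F).subset h, le_trans (by
      exact_mod_cast (Set.ncard_le_ncard h (hfin.image F)).trans (Set.ncard_image_le hfin)) hcard⟩
  have hinj : Function.Injective fun x : Drinfeld.DrinfeldModule.SelfPair K 3 a =>
      (⟨(x.mod, x.isog), Drinfeld.DrinfeldModule.mem_monicEndPairs hgen ham ha x.cyclic x.monic⟩ :
        Drinfeld.DrinfeldModule.monicEndPairs Fq K) := by
    rintro ⟨φ, f, _, _⟩ ⟨ψ, g, _, _⟩ h
    simp only [Subtype.mk.injEq, Prod.mk.injEq] at h
    obtain ⟨rfl, rfl⟩ := h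
    rfl
  have := hfin.to_subtype
  have hpair : Finite (Drinfeld.DrinfeldModule.SelfPair K 3 a) := Finite.of_injective _ hinj
  have hquot : ∀ s : Setoid (Drinfeld.DrinfeldModule.SelfPair K 3 a),
      ∀ v : Quotient s → K, ((∏ᶠ x, (X - C (v x))).natDegree : ℤ) ≤ Drinfeld.boundN q := by
    intro s v
    refine le_trans ?_ hcard
    have h1 : Nat.card (Quotient s) ≤ Nat.card (Drinfeld.DrinfeldModule.SelfPair K 3 a) :=
      Nat.card_le_card_of_surjective _ Quotient.mk_surjective
    have h2 := Nat.card_le_card_of_injective _ hinj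
    rw [Nat.card_coe_set_eq] at h2
    exact_mod_cast ((Drinfeld.DrinfeldModule.natDegree_finprod_X_sub_C_le v).trans h1).trans h2
  refine ⟨hsub Prod.fst _ ?_, hsub (fun x => Quotient.mk _ x.1) _ ?_,
    ⟨inferInstance, fun J => hquot _ _⟩, ⟨inferInstance, fun J => hquot _ _⟩⟩
  · rintro φ ⟨f, hf, hm⟩
    exact ⟨(φ, f), Drinfeld.DrinfeldModule.mem_monicEndPairs hgen ham ha hf hm, rfl⟩
  · rintro _ ⟨φ, rfl, f, hf⟩
    obtain ⟨x, hx, hiso⟩ := Drinfeld.DrinfeldModule.exists_iso_mem_monicEndPairs hgen ham ha hf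
    exact ⟨x, hx, Quotient.sound hiso⟩
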